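/- All notions are the following. A \emph{right loop} is a set $S$ with a binary operation $\circ$ and a two-sided identity $1$ such that every equation $X\circ a=b$ ($a,b\in S$) has a unique solution $X\in S$. A \emph{right subloop} of $S$ is a non-empty subset closed under $\circ$ that is a right loop under the induced operation; a \emph{congruence} on $S$ is an equivalence relation on $S$ that is a right subloop of $S\times S$. An \emph{invariant right subloop} $T$ of $S$ is the class of $1$ under a congruence $R$, and $S/T:=S/R$ is the quotient right loop. A congruence $\gamma$ on $S$ \emph{centralizes} a congruence $\beta$ on $S$ by means of a congruence $C$ on the right loop $\beta\subseteq S\times S$ if, for all pairs below that lie in $\beta$: (i) $(x,y)\,C\,(u,v)$ implies $x\,\gamma\,u$; (ii) for each $(x,y)\in\beta$ the map $(u,v)\mapsto u$ is a bijection from the $C$-class of $(x,y)$ onto the $\gamma$-class of $x$; (iii) $x\,\gamma\,y$ implies $(x,x)\,C\,(y,y)$; (iv) $(x,y)\,C\,(u,v)$ implies $(y,x)\,C\,(v,u)$; (v) $(x,y)\,C\,(u,v)$ and $(y,z)\,C\,(v,w)$ imply $(x,z)\,C\,(u,w)$. A congruence $\alpha$ is \emph{central} if it is centralized by $S\times S$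 by means of some $C$. There is a greatest central congruence $\zeta(S)$, and the \emph{center} $\mathcal Z(S)$ is the $\zeta(S)$-class of $1$. The right loop $S$ is \emph{nilpotent} if for some $n\in\mathbb N$ there are invariant right subloops $\{1\}=\mathcal Z_0\subseteq\mathcal Z_1\subseteq\cdots\subseteq\mathcal Z_n=S$ with $\mathcal Z_{i+1}/\mathcal Z_i=\mathcal Z(S/\mathcal Z_i)$ for $0\le i<n$. Let $G$ be a (possibly infinite) group and $H$ a subgroup of $G$. A \emph{transversal} of $H$ in $G$ is a subset $S\subseteq G$ containing exactly one element of each right coset $Hg$, and containing $1$. It is a right loop under $\{x\circ y\}=S\cap Hxy$, and it is called nilpotent if this right loop is nilpotent; it is \emph{generating} if $\langle S\rangle=G$. The subgroup $H$ is \emph{core-free} if it contains no non-trivial normal subgroup of $G$. \textbf{Corollary.} If a core-free subgroup $H$ of a group $G$ has a generating transversal that is nilpotent, then $H$ is solvable. -/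

import Mathlib

universe u

/-- A right loop: a set with a binary operation and a two-sided identity `1`, in which every
equation `X * a = b` has a unique solution `X`. -/
class RightLoop (S : Type u) extends MulOneClass S where
  existsUnique_mul_eq : ∀ a b : S, ∃! x : S, x * a = b

namespace RightLoop

theorem mul_cancel {S : Type u} [RightLoop S] {a x y : S} (h : x * a = y * a) : x = y :=
  (existsUnique_mul_eq a (y * a)).unique h rfl

instance instProd {S T : Type u} [RightLoop S] [RightLoop T] : RightLoop (S × T) where
  existsUnique_mul_eq := by
    rintro ⟨a, a'⟩ ⟨b, b'⟩
    obtain ⟨x, hx, -⟩ := existsUnique_mul_eq a b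
    obtain ⟨y, hy, -⟩ := existsUnique_mul_eq a' b'
    refine ⟨(x, y), Prod.ext hx hy, ?_⟩
    rintro ⟨u, v⟩ h
    have h1 : u * a = b := congrArg Prod.fst h
    have h2 : v * a' = b' := congrArg Prod.snd h
    exact Prod.ext (mul_cancel (h1.trans hx.symm)) (mul_cancel (h2.trans hy.symm))

/-- A right subloop: a non-empty subset that is closed under the operation and is a right loop
with respect to the induced operation. -/
structure IsRightSubloop {S : Type u} [RightLoop S] (T : Set S) : Prop where
  nonempty : T.Nonempty
  mul_mem : ∀ a ∈ T, ∀ b ∈ T, a * b ∈ T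
  exists_identity : ∃ e ∈ T, ∀ a ∈ T, e * a = a ∧ a * e = a
  existsUnique_mul_eq : ∀ a ∈ T, ∀ b ∈ T, ∃! x, x ∈ T ∧ x * a = b

theorem IsRightSubloop.one_mem {S : Type u} [RightLoop S] {T : Set S} (hT : IsRightSubloop T) :
    (1 : S) ∈ T := by
  obtain ⟨e, he, h⟩ := hT.exists_identity
  have h1 : e = 1 := mul_cancel (a := e) (by rw [(h e he).1, one_mul])
  exact h1 ▸ he

/-- The induced right loop structure on a right subloop. -/
abbrev IsRightSubloop.rightLoop {S : Type u} [RightLoop S] {T : Set S} (hT : IsRightSubloop T) :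
    RightLoop T where
  mul a b := ⟨a.1 * b.1, hT.mul_mem a.1 a.2 b.1 b.2⟩
  one := ⟨1, hT.one_mem⟩
  one_mul a := Subtype.ext (one_mul a.1)
  mul_one a := Subtype.ext (mul_one a.1)
  existsUnique_mul_eq := by
    intro a b
    obtain ⟨x, ⟨hxT, hx⟩, -⟩ := hT.existsUnique_mul_eq a.1 a.2 b.1 b.2
    refine ⟨⟨x, hxT⟩, Subtype.ext hx, ?_⟩
    intro y hy
    have hy' : y.1 * a.1 = b.1 := congrArg Subtype.val hy
    exact Subtype.ext (mul_cancel (hy'.trans hx.symm))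

/-- A congruence on `S`: an equivalence relation that is a right subloop of `S × S`. -/
structure Congruence (S : Type u) [RightLoop S] extends Setoid S where
  isRightSubloop : IsRightSubloop {p : S × S | toSetoid p.1 p.2}

namespace Congruence

variable {S : Type u} [RightLoop S]

theorem refl (α : Congruence S) (x : S) : α.toSetoid x x := α.toSetoid.refl' x

theorem symm (α : Congruence S) {x y : S} (h : α.toSetoid x y) : α.toSetoid y x :=
  α.toSetoid.symm' h

theorem trans (α : Congruence S) {x y z : S} (h : α.toSetoid x y) (h' : α.toSetoid y z) :
    α.toSetoid x z :=
  α.toSetoid.trans' h h'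

theorem mul (α : Congruence S) {a b c d : S} (h : α.toSetoid a b) (h' : α.toSetoid c d) :
    α.toSetoid (a * c) (b * d) :=
  α.isRightSubloop.mul_mem (a, b) h (c, d) h'

theorem of_mul (α : Congruence S) {a b x y : S} (h : α.toSetoid a b)
    (h' : α.toSetoid (x * a) (y * b)) : α.toSetoid x y := by
  obtain ⟨p, ⟨hp, hp'⟩, -⟩ := α.isRightSubloop.existsUnique_mul_eq (a, b) h (x * a, y * b) h'
  have h1 : p.1 = x := mul_cancel (a := a) (congrArg Prod.fst hp')
  have h2 : p.2 = y := mul_cancel (a := b) (congrArg Prod.snd hp')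
  have h3 : α.toSetoid p.1 p.2 := hp
  rwa [h1, h2] at h3

/-- An equivalence relation compatible with the operation and with right division is a right
subloop of `S × S`, hence a congruence. -/
def ofSetoid (r : Setoid S) (mul : ∀ a b c d : S, r a b → r c d → r (a * c) (b * d))
    (of_mul : ∀ a b x y : S, r a b → r (x * a) (y * b) → r x y) : Congruence S where
  toSetoid := r
  isRightSubloop :=
    { nonempty := ⟨(1, 1), r.refl' 1⟩
      mul_mem := fun p hp q hq => mul p.1 p.2 q.1 q.2 hp hq
      exists_identity := ⟨1, r.refl' 1, fun p _ => ⟨one_mul p, mul_one p⟩⟩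
      existsUnique_mul_eq := by
        intro p hp q hq
        obtain ⟨x, hx, hu⟩ := RightLoop.existsUnique_mul_eq p q
        refine ⟨x, ⟨of_mul p.1 p.2 x.1 x.2 hp ?_, hx⟩, fun y hy => hu y hy.2⟩
        have h1 : x.1 * p.1 = q.1 := congrArg Prod.fst hx
        have h2 : x.2 * p.2 = q.2 := congrArg Prod.snd hx
        rw [h1, h2]
        exact hq }

/-- The total congruence `S × S`. -/
def total (S : Type u) [RightLoop S] : Congruence S :=
  ofSetoid ⊤ (fun _ _ _ _ _ _ => trivial) (fun _ _ _ _ _ _ => trivial)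

/-- The congruence `α`, regarded as a subset of `S × S`. -/
abbrev graph (α : Congruence S) : Set (S × S) := {p | α.toSetoid p.1 p.2}

instance instGraph (α : Congruence S) : RightLoop α.graph := α.isRightSubloop.rightLoop

/-- The equivalence class of the identity; the sets of this form are the invariant right
subloops of `S`. -/
def oneClass (α : Congruence S) : Set S := {x | α.toSetoid x 1}

/-- The quotient right loop `S / α`. -/
abbrev Quot (α : Congruence S) : Type u := Quotient α.toSetoid

/-- The natural projection `S → S / α`. -/
abbrev proj (α : Congruence S) (x : S) : α.Quot := Quotient.mk α.toSetoid x

instance instQuot (α : Congruence S) : RightLoop α.Quot where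
  mul := Quotient.map₂ (· * ·) (fun _ _ h _ _ h' => α.mul h h')
  one := α.proj 1
  one_mul := by
    rintro ⟨a⟩
    exact congrArg α.proj (one_mul a)
  mul_one := by
    rintro ⟨a⟩
    exact congrArg α.proj (mul_one a)
  existsUnique_mul_eq := by
    rintro ⟨a⟩ ⟨b⟩
    obtain ⟨x, hx, -⟩ := RightLoop.existsUnique_mul_eq a b
    refine ⟨α.proj x, congrArg α.proj hx, ?_⟩
    rintro ⟨y⟩ hy
    have h : α.toSetoid (y * a) b := Quotient.exact hy
    exact Quotient.sound (α.of_mul (α.refl a) (by rw [hx]; exact h))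

/-- `γ` centralizes `β` by means of the centering congruence `C`, a congruence on the right
loop `β ⊆ S × S`. -/
structure Centralizes (γ β : Congruence S) (C : Congruence β.graph) : Prop where
  fst_rel : ∀ p q : β.graph, C.toSetoid p q → γ.toSetoid p.1.1 q.1.1
  bijOn : ∀ p : β.graph,
    Set.BijOn (fun q : β.graph => q.1.1) {q | C.toSetoid p q} {w | γ.toSetoid p.1.1 w}
  diag : ∀ x y : S, γ.toSetoid x y → C.toSetoid ⟨(x, x), β.refl x⟩ ⟨(y, y), β.refl y⟩
  swap : ∀ (x y u v : S) (hxy : β.toSetoid x y) (huv : β.toSetoid u v),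
    C.toSetoid ⟨(x, y), hxy⟩ ⟨(u, v), huv⟩ →
      C.toSetoid ⟨(y, x), β.symm hxy⟩ ⟨(v, u), β.symm huv⟩
  comp : ∀ (x y z u v w : S) (hxy : β.toSetoid x y) (hyz : β.toSetoid y z)
    (huv : β.toSetoid u v) (hvw : β.toSetoid v w),
    C.toSetoid ⟨(x, y), hxy⟩ ⟨(u, v), huv⟩ → C.toSetoid ⟨(y, z), hyz⟩ ⟨(v, w), hvw⟩ →
      C.toSetoid ⟨(x, z), β.trans hxy hyz⟩ ⟨(u, w), β.trans huv hvw⟩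

/-- A central congruence: one that is centralized by `S × S`. -/
def IsCentral (α : Congruence S) : Prop :=
  ∃ C : Congruence α.graph, (total S).Centralizes α C

instance instPartialOrder : PartialOrder (Congruence S) :=
  PartialOrder.lift toSetoid (fun α β h => by cases α; cases β; cases h; rfl)

end Congruence

/-- The center congruence `ζ(S)`: the join of all central congruences, that is, the smallest
congruence containing them. By `centerCongruence_isGreatest` it is itself central, so it is the
unique maximal central congruence. -/
def centerCongruence (S : Type u) [RightLoop S] : Congruence S :=
  Congruence.ofSetoid
    { r := fun x y => ∀ δ : Congruence S, (∀ α : Congruence S, α.IsCentral → α ≤ δ) →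
        δ.toSetoid x y
      iseqv :=
        { refl := fun x δ _ => δ.refl x
          symm := fun h δ hδ => δ.symm (h δ hδ)
          trans := fun h h' δ hδ => δ.trans (h δ hδ) (h' δ hδ) } }
    (fun _ _ _ _ h h' δ hδ => δ.mul (h δ hδ) (h' δ hδ))
    (fun _ _ _ _ h h' δ hδ => δ.of_mul (h δ hδ) (h' δ hδ))

/-- The center `Z(S)`: the class of the identity under the center congruence. -/
def center (S : Type u) [RightLoop S] : Set S := (centerCongruence S).oneClass

/-- A right loop `S` is nilpotent if it has a central series
`{1} = Z₀ ≤ Z₁ ≤ ⋯ ≤ Zₙ = S` of invariant right subloops with `Zᵢ₊₁ / Zᵢ = Z(S / Zᵢ)`.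
The invariant right subloop `Zᵢ` is given as the class of `1` under the congruence `R i`, so that
`S / Zᵢ` is `S / R i`. -/
def IsNilpotent (S : Type u) [RightLoop S] : Prop :=
  ∃ (n : ℕ) (R : ℕ → Congruence S),
    (R 0).oneClass = {1} ∧ (R n).oneClass = Set.univ ∧
    ∀ i < n, (R i).oneClass ⊆ (R (i + 1)).oneClass ∧
      (R i).proj '' (R (i + 1)).oneClass = center (R i).Quot

section CenterIsCentral

variable {S : Type u} [RightLoop S]

/-- Auxiliary description of the elements of the center. -/
def IsCentralElt (z : S) : Prop :=
  (∀ x, z * x = x * z) ∧ (∀ x y, (z * x) * y = z * (x * y)) ∧ ∀ x y, x * (z * y) = z * (x * y)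

theorem IsCentralElt.of_isCentral {α : Congruence S} (hα : α.IsCentral) {z : S}
    (hz : α.toSetoid z 1) : IsCentralElt z := by
  obtain ⟨C, hC⟩ := hα
  let Z : α.graph := ⟨(z, 1), hz⟩
  let D : S → α.graph := fun x => ⟨(x, x), α.refl x⟩
  have hD : ∀ x : S, C.toSetoid 1 (D x) := fun x => hC.diag 1 x trivial
  have hL : ∀ (p q : α.graph) (x : S), C.toSetoid p q → C.toSetoid p (q * D x) := by
    intro p q x h
    have h' := C.mul h (hD x)
    rwa [mul_one] at h'
  have hR : ∀ (p q : α.graph) (x : S), C.toSetoid p q → C.toSetoid p (D x * q) := by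
    intro p q x h
    have h' := C.mul (hD x) h
    rwa [one_mul] at h'
  have hinj : ∀ p q : α.graph, C.toSetoid p q → p.1.2 = q.1.2 → p.1.1 = q.1.1 := by
    rintro ⟨⟨a, y⟩, ha⟩ ⟨⟨b, y'⟩, hb⟩ h rfl
    have h' := hC.swap _ _ _ _ _ _ h
    have h2 := (hC.bijOn ⟨(y, a), α.symm ha⟩).injOn (C.refl _) h' rfl
    exact congrArg (fun q : α.graph => q.1.2) h2
  have hZ := C.refl Z
  refine ⟨fun x => ?_, fun x y => ?_, fun x y => ?_⟩
  · exact hinj _ _ (C.trans (C.symm (hL Z Z x hZ)) (hR Z Z x hZ))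
      ((one_mul x).trans (mul_one x).symm)
  · refine hinj _ _ (C.trans (C.symm (hL Z _ y (hL Z Z x hZ))) (hL Z Z (x * y) hZ)) ?_
    change (1 * x) * y = 1 * (x * y)
    rw [one_mul, one_mul]
  · refine hinj _ _ (C.trans (C.symm (hR Z _ x (hL Z Z y hZ))) (hL Z Z (x * y) hZ)) ?_
    change x * (1 * y) = 1 * (x * y)
    rw [one_mul, one_mul]

theorem IsCentralElt.one : IsCentralElt (1 : S) := by
  simp [IsCentralElt]

theorem IsCentralElt.mul {z w : S} (hz : IsCentralElt z) (hw : IsCentralElt w) :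
    IsCentralElt (z * w) := by
  obtain ⟨z1, z2, z3⟩ := hz
  obtain ⟨w1, w2, w3⟩ := hw
  refine ⟨fun x => ?_, fun x y => ?_, fun x y => ?_⟩
  · rw [z2, z3, w1]
  · rw [z2, z2, w2, z2]
  · rw [z2, z3, w3, z2]

theorem IsCentralElt.inv {z : S} (hz : IsCentralElt z) :
    ∃ z', IsCentralElt z' ∧ z' * z = 1 ∧ z * z' = 1 := by
  obtain ⟨z1, z2, z3⟩ := hz
  obtain ⟨z', h, -⟩ := existsUnique_mul_eq z 1
  have h' : z * z' = 1 := (z1 z').trans h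
  have inj : ∀ a b : S, z * a = z * b → a = b := fun a b hab =>
    mul_cancel (a := z) (by rw [← z1, ← z1, hab])
  have c : ∀ x, z * (z' * x) = x := fun x => by rw [← z2, h', one_mul]
  refine ⟨z', ⟨fun x => inj _ _ ?_, fun x y => inj _ _ ?_, fun x y => inj _ _ ?_⟩, h, h'⟩
  · rw [c, ← z3, h', mul_one]
  · rw [c, ← z2, c]
  · rw [c, ← z3, c]

theorem IsCentralElt.mul_mul_mul {z w : S} (hz : IsCentralElt z) (hw : IsCentralElt w)
    (x y : S) : (z * x) * (w * y) = (z * w) * (x * y) := by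
  rw [hz.2.1, hw.2.2, hz.2.1]

def centralEltCongruence (S : Type u) [RightLoop S] : Congruence S :=
  Congruence.ofSetoid
    { r := fun x y => ∃ z, IsCentralElt z ∧ z * y = x
      iseqv :=
        { refl := fun x => ⟨1, .one, one_mul x⟩
          symm := by
            rintro _ y ⟨z, hz, rfl⟩
            obtain ⟨z', hz', h, -⟩ := hz.inv
            exact ⟨z', hz', by rw [← hz'.2.1, h, one_mul]⟩
          trans := by
            rintro _ _ y ⟨z, hz, rfl⟩ ⟨w, hw, rfl⟩
            exact ⟨z * w, hz.mul hw, hz.2.1 w y⟩ } }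
    (by
      rintro _ b _ d ⟨z, hz, rfl⟩ ⟨w, hw, rfl⟩
      exact ⟨z * w, hz.mul hw, (hz.mul_mul_mul hw b d).symm⟩)
    (by
      rintro _ b x y ⟨z, hz, rfl⟩ ⟨w, hw, h⟩
      obtain ⟨z', hz', hzz, hzz'⟩ := hz.inv
      refine ⟨z' * w, hz'.mul hw, mul_cancel (a := z * b) ?_⟩
      rw [← h, (hz'.mul hw).mul_mul_mul hz, hz'.2.1, ← hz.1 w, ← hz'.2.1, hzz, one_mul])

theorem centralEltCongruence_isCentral : (centralEltCongruence S).IsCentral := by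
  let α := centralEltCongruence S
  have hα : ∀ x y, α.toSetoid x y → ∃ z, IsCentralElt z ∧ z * y = x := fun _ _ h => h
  refine ⟨Congruence.ofSetoid
    { r := fun p q : α.graph => ∃ z, IsCentralElt z ∧ z * p.1.2 = p.1.1 ∧ z * q.1.2 = q.1.1
      iseqv :=
        { refl := fun p => by
            obtain ⟨z, hz, h⟩ := hα _ _ p.2
            exact ⟨z, hz, h, h⟩
          symm := fun ⟨z, hz, h, h'⟩ => ⟨z, hz, h', h⟩
          trans := by
            rintro p q r ⟨z, hz, h, h'⟩ ⟨w, hw, k, k'⟩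
            obtain rfl : z = w := mul_cancel (h'.trans k.symm)
            exact ⟨z, hz, h, k'⟩ } } ?_ ?_, ?_⟩
  · rintro p q r s ⟨z, hz, h, h'⟩ ⟨w, hw, k, k'⟩
    refine ⟨z * w, hz.mul hw, ?_, ?_⟩
    · change (z * w) * (p.1.2 * r.1.2) = p.1.1 * r.1.1
      rw [← h, ← k, hz.mul_mul_mul hw]
    · change (z * w) * (q.1.2 * s.1.2) = q.1.1 * s.1.1
      rw [← h', ← k', hz.mul_mul_mul hw]
  · rintro p q x y ⟨z, hz, h, h'⟩ ⟨w, hw, k, k'⟩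
    have k : w * (x.1.2 * p.1.2) = x.1.1 * p.1.1 := k
    have k' : w * (y.1.2 * q.1.2) = y.1.1 * q.1.1 := k'
    obtain ⟨v, hv, e⟩ := hα _ _ x.2
    obtain ⟨v', hv', e'⟩ := hα _ _ y.2
    rw [← h, ← e, hv.mul_mul_mul hz] at k
    rw [← h', ← e', hv'.mul_mul_mul hz] at k'
    have hvv : v = v' := mul_cancel ((mul_cancel k).symm.trans (mul_cancel k'))
    exact ⟨v, hv, e, by rw [hvv, e']⟩
  · refine ⟨fun _ _ _ => trivial, fun p => ⟨fun _ _ => trivial, ?_, ?_⟩, fun x y _ => ?_, ?_, ?_⟩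
    · rintro ⟨⟨a, b⟩, hq⟩ ⟨z, hz, h, h'⟩ ⟨⟨c, d⟩, hr⟩ ⟨w, hw, k, k'⟩ e
      obtain rfl : a = c := e
      obtain rfl : z = w := mul_cancel (h.trans k.symm)
      have h' : z * b = a := h'
      have k' : z * d = a := k'
      obtain rfl : b = d := mul_cancel (a := z) (by rw [← hz.1, ← hz.1, h', k'])
      rfl
    · intro a _
      obtain ⟨z, hz, h⟩ := hα _ _ p.2
      obtain ⟨z', hz', -, h'⟩ := hz.inv
      have e : z * (z' * a) = a := by rw [← hz.2.1, h', one_mul]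
      exact ⟨⟨(a, z' * a), ⟨z, hz, e⟩⟩, ⟨z, hz, h, e⟩, rfl⟩
    · exact ⟨1, .one, one_mul x, one_mul y⟩
    · rintro x y u v hxy huv ⟨z, hz, h, h'⟩
      obtain ⟨z', hz', e, -⟩ := hz.inv
      refine ⟨z', hz', ?_, ?_⟩
      · change z' * x = y
        have h : z * y = x := h
        rw [← h, ← hz'.2.1, e, one_mul]
      · change z' * u = v
        have h' : z * v = u := h'
        rw [← h', ← hz'.2.1, e, one_mul]
    · rintro x y z u v w hxy hyz huv hvw ⟨s, hs, h, h'⟩ ⟨t, ht, k, k'⟩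
      refine ⟨s * t, hs.mul ht, ?_, ?_⟩
      · change (s * t) * z = x
        exact (hs.2.1 t z).trans ((congrArg (s * ·) k).trans h)
      · change (s * t) * w = u
        exact (hs.2.1 t w).trans ((congrArg (s * ·) k').trans h')

/-- The center congruence is the greatest central congruence. -/
theorem centerCongruence_isGreatest (S : Type u) [RightLoop S] :
    IsGreatest {α : Congruence S | α.IsCentral} (centerCongruence S) := by
  have hub : ∀ α : Congruence S, α.IsCentral → α ≤ centralEltCongruence S := by
    intro α hα x y hxy
    obtain ⟨z, hz, -⟩ := existsUnique_mul_eq y x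
    refine ⟨z, .of_isCentral hα (α.of_mul (α.refl y) ?_), hz⟩
    rwa [hz, one_mul]
  have heq : centerCongruence S = centralEltCongruence S :=
    le_antisymm (fun x y h => h _ hub)
      (fun x y h δ hδ => hδ _ centralEltCongruence_isCentral h)
  refine ⟨?_, fun α hα x y h δ hδ => hδ α hα h⟩
  rw [heq]
  exact centralEltCongruence_isCentral

end CenterIsCentral

end RightLoop

/-- A (right) transversal of `H` in `G`: a subset containing exactly one element of every right
coset of `H`, and containing `1`. -/
structure IsRightTransversal {G : Type u} [Group G] (H : Subgroup G) (S : Set G) : Prop where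
  isComplement : Subgroup.IsComplement (H : Set G) S
  one_mem : (1 : G) ∈ S

namespace IsRightTransversal

variable {G : Type u} [Group G] {H : Subgroup G} {S : Set G}

theorem existsUnique (hS : IsRightTransversal H S) (g : G) : ∃! s : S, (s : G) * g⁻¹ ∈ H := by
  obtain ⟨s, hs, hu⟩ := Subgroup.isComplement_iff_existsUnique_mul_inv_mem.1 hS.isComplement g
  refine ⟨s, ?_, fun t ht => hu t ?_⟩
  · simpa using H.inv_mem hs
  · simpa using H.inv_mem ht

/-- `hS.op x y` is the unique element of `S ∩ H x y`. -/
noncomputable def op (hS : IsRightTransversal H S) (x y : S) : S :=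
  (hS.existsUnique ((x : G) * y)).choose

theorem op_mem (hS : IsRightTransversal H S) (x y : S) :
    (hS.op x y : G) * ((x : G) * y)⁻¹ ∈ H :=
  (hS.existsUnique ((x : G) * y)).choose_spec.1

theorem op_eq_iff (hS : IsRightTransversal H S) (x y s : S) :
    hS.op x y = s ↔ (s : G) * ((x : G) * y)⁻¹ ∈ H :=
  ⟨fun h => h ▸ hS.op_mem x y, fun h => (hS.existsUnique _).unique (hS.op_mem x y) h⟩

/-- The right loop structure induced on a transversal: `{x ∘ y} = S ∩ H x y`. -/
noncomputable abbrev rightLoop (hS : IsRightTransversal H S) : RightLoop S where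
  mul := hS.op
  one := ⟨1, hS.one_mem⟩
  one_mul x := (hS.op_eq_iff _ _ _).2 (by
    change (x : G) * (1 * (x : G))⁻¹ ∈ H
    simp)
  mul_one x := (hS.op_eq_iff _ _ _).2 (by
    change (x : G) * ((x : G) * 1)⁻¹ ∈ H
    simp)
  existsUnique_mul_eq := by
    intro a b
    have key : ∀ x : S, hS.op x a = b ↔ (x : G) * ((b : G) * (a : G)⁻¹)⁻¹ ∈ H := by
      intro x
      rw [op_eq_iff, ← H.inv_mem_iff]
      simp [mul_assoc]
    obtain ⟨x, hx, hu⟩ := hS.existsUnique ((b : G) * (a : G)⁻¹)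
    exact ⟨x, (key x).2 hx, fun y hy => hu y ((key y).1 hy)⟩

/-- A transversal is nilpotent if it is nilpotent as a right loop with the induced structure. -/
def IsNilpotent (hS : IsRightTransversal H S) : Prop :=
  @RightLoop.IsNilpotent S hS.rightLoop

end IsRightTransversal

/-! ### Solvability of the right multiplication group -/

namespace RightLoop

variable {S : Type u} [RightLoop S]

/-! The action of `G` on the right cosets of `H`, carried over to `S`, is faithful because `H` is
core-free. Each `s ∈ S` acts, up to inversion, as right translation by `s` in the right loop. As `S`
generates `G`, the group `G` embeds in the right multiplication group of `S`, and it is enough that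
this group is solvable. For that, let `K i` consist of the permutations acting trivially on `S / R
i`. An element of `K (i + 1)` sends each `x` to some `z * x` with `z` central modulo `R i`. The
whole group commutes modulo `R i` with left translations by such `z`, so two elements of `K (i + 1)`
commute modulo `R i` (`Congruence.commutator_kernel_le`). The derived series therefore descends
through the `K i` to `K 0`, which is trivial. -/

/-- The right translation `x ↦ x * a` of a right loop. -/
noncomputable def rightTranslation (a : S) : Equiv.Perm S :=
  Equiv.ofBijective (· * a)
    ⟨fun _ _ h => mul_cancel h, fun b => (existsUnique_mul_eq a b).exists⟩

/-- The right multiplication group of a right loop. -/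
def rightMulGroup (S : Type u) [RightLoop S] : Subgroup (Equiv.Perm S) :=
  Subgroup.closure (Set.range rightTranslation)

/-- Compatibility with multiplication and with right division gives the two directions for a
translation. The equivalence, rather than one implication, is what lets the induction pass to
inverses. -/
theorem Congruence.rel_perm_iff (α : Congruence S) {g : Equiv.Perm S} (hg : g ∈ rightMulGroup S) :
    ∀ x y : S, α.toSetoid (g x) (g y) ↔ α.toSetoid x y := by
  induction hg using Subgroup.closure_induction with
  | mem g hg =>
    obtain ⟨a, rfl⟩ := hg
    exact fun x y => ⟨fun h => α.of_mul (α.refl a) h, fun h => α.mul h (α.refl a)⟩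
  | one => exact fun x y => Iff.rfl
  | mul g h _ _ ihg ihh => exact fun x y => (ihg _ _).trans (ihh x y)
  | inv g _ ih => exact fun x y => by rw [← ih (g⁻¹ x) (g⁻¹ y)]; simp

/-- Cancel `y` on the right in `z * y ~ 1 * y`. A displacement inside a class thus becomes a left
multiplication from the class of `1`. -/
theorem Congruence.exists_mul_eq (α : Congruence S) {x y : S} (h : α.toSetoid x y) :
    ∃ z ∈ α.oneClass, z * y = x := by
  obtain ⟨z, hz, -⟩ := existsUnique_mul_eq y x
  refine ⟨z, α.of_mul (α.refl y) ?_, hz⟩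
  rwa [hz, one_mul]

theorem isCentralElt_of_mem_center {z : S} (hz : z ∈ center S) : IsCentralElt z :=
  .of_isCentral (centerCongruence_isGreatest S).1 hz

/-- Permutations in the right multiplication group commute, modulo `α`, with left translations
by elements that are central modulo `α`. -/
theorem Congruence.perm_mul_rel (α : Congruence S) {g : Equiv.Perm S}
    (hg : g ∈ rightMulGroup S) {z : S} (hz : IsCentralElt (α.proj z)) :
    ∀ x : S, α.toSetoid (g (z * x)) (z * g x) := by
  induction hg using Subgroup.closure_induction with
  | mem g hg =>
    obtain ⟨a, rfl⟩ := hg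
    exact fun x => Quotient.exact (hz.2.1 (α.proj x) (α.proj a))
  | one => exact fun x => α.refl _
  | mul g h hg _ ihg ihh =>
    exact fun x => α.trans ((α.rel_perm_iff hg _ _).2 (ihh x)) (ihg (h x))
  | inv g hg ih =>
    intro x
    rw [← α.rel_perm_iff hg]
    simpa using α.symm (ih (g⁻¹ x))

/-- The elements of the right multiplication group that act trivially modulo `α`. -/
def Congruence.kernel (α : Congruence S) : Subgroup (rightMulGroup S) where
  carrier := {g | ∀ x, α.toSetoid (g.1 x) x}
  one_mem' := α.refl
  mul_mem' := fun {g h} hg hh x => α.trans (hg (h.1 x)) (hh x)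
  inv_mem' := fun {g} hg x => by simpa using α.symm (hg (g.1⁻¹ x))

/-- If `β / α` is central in `S / α`, then the permutations acting trivially modulo `β` commute
modulo `α`. -/
theorem Congruence.commutator_kernel_le {α β : Congruence S}
    (h : ∀ z ∈ β.oneClass, IsCentralElt (α.proj z)) : ⁅β.kernel, β.kernel⁆ ≤ α.kernel := by
  rw [Subgroup.commutator_le]
  intro g hg k hk
  -- The multipliers `z` and `w` depend on `x`; this is harmless because the two products are
  -- compared one point at a time.
  have key : ∀ x, α.toSetoid (g.1 (k.1 x)) (k.1 (g.1 x)) := by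
    intro x
    obtain ⟨z, hz, ez⟩ := β.exists_mul_eq (hg x)
    obtain ⟨w, hw, ew⟩ := β.exists_mul_eq (hk x)
    have h1 : α.toSetoid (g.1 (k.1 x)) (w * (z * x)) := by
      rw [← ew, ez]
      exact α.perm_mul_rel g.2 (h w hw) x
    have h2 : α.toSetoid (k.1 (g.1 x)) (z * (w * x)) := by
      rw [← ez, ew]
      exact α.perm_mul_rel k.2 (h z hz) x
    have h3 : α.toSetoid (w * (z * x)) (z * (w * x)) :=
      Quotient.exact ((h w hw).2.2 (α.proj z) (α.proj x)).symm
    exact α.trans h1 (α.trans h3 (α.symm h2))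
  intro x
  -- At this point the right side of `key` collapses to `x` and the left side is the commutator
  -- applied to `x`.
  simpa [commutatorElement_def] using key (g.1⁻¹ (k.1⁻¹ x))

/-- The indexing is reversed: the central series ascends while the derived series descends, so step
`k` is matched with `R (n - k)`. -/
theorem IsNilpotent.isSolvable_rightMulGroup (h : IsNilpotent S) :
    Group.IsSolvable (rightMulGroup S) := by
  obtain ⟨n, R, h0, hn, hR⟩ := h
  have hle : ∀ k ≤ n, derivedSeries (rightMulGroup S) k ≤ (R (n - k)).kernel := by
    intro k
    induction k with
    | zero =>
      intro _ g _ x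
      have hall : ∀ y, (R n).toSetoid y 1 := fun y => (Set.ext_iff.1 hn y).2 trivial
      exact (R n).trans (hall _) ((R n).symm (hall x))
    | succ k ih =>
      intro hk
      have e : n - k = n - (k + 1) + 1 := by omega
      refine (Subgroup.commutator_mono (ih (by omega)) (ih (by omega))).trans ?_
      rw [e]
      refine Congruence.commutator_kernel_le fun z hz => isCentralElt_of_mem_center ?_
      rw [← (hR (n - (k + 1)) (by omega)).2]
      exact Set.mem_image_of_mem _ hz
  refine ⟨⟨n, ?_⟩⟩
  rw [eq_bot_iff]
  intro g hg
  have hg' := hle n le_rfl hg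
  rw [Nat.sub_self] at hg'
  refine Subtype.ext (Equiv.ext fun x => ?_)
  -- The class of `1` under `R 0` is `{1}`, so `z = 1` and `g` fixes `x`.
  obtain ⟨z, hz, e⟩ := (R 0).exists_mul_eq (hg' x)
  rw [h0] at hz
  rw [← e, hz, one_mul]
  rfl

end RightLoop

/-! ### The coset action on a transversal -/

namespace IsRightTransversal

variable {G : Type u} [Group G] {H : Subgroup G} {S : Set G}

/-- The representative in `S` of the coset `H g`. -/
noncomputable def rep (hS : IsRightTransversal H S) (g : G) : S := (hS.existsUnique g).choose

theorem rep_mem (hS : IsRightTransversal H S) (g : G) : (hS.rep g : G) * g⁻¹ ∈ H :=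
  (hS.existsUnique g).choose_spec.1

theorem rep_eq_iff (hS : IsRightTransversal H S) (g : G) (s : S) :
    hS.rep g = s ↔ (s : G) * g⁻¹ ∈ H :=
  ⟨fun h => h ▸ hS.rep_mem g, fun h => (hS.existsUnique g).unique (hS.rep_mem g) h⟩

/-- `g` and its representative span the same right coset, and right multiplication respects right
cosets. This makes `toPerm` multiplicative. -/
theorem rep_rep_mul (hS : IsRightTransversal H S) (g k : G) :
    hS.rep (hS.rep g * k) = hS.rep (g * k) := by
  rw [rep_eq_iff]
  have := H.mul_mem (hS.rep_mem (g * k)) (H.inv_mem (hS.rep_mem g))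
  simpa [mul_assoc] using this

theorem rep_coe (hS : IsRightTransversal H S) (s : S) : hS.rep s = s :=
  (hS.rep_eq_iff _ _).2 (by simp)

/-- The action of `G` on the right cosets of `H`, transported to the transversal `S`;
the element `g` sends the coset of `x` to that of `x * g⁻¹`. -/
noncomputable def toPerm (hS : IsRightTransversal H S) : G →* Equiv.Perm S :=
  MonoidHom.toHomPerm
    { toFun := fun g x => hS.rep (x * g⁻¹)
      map_one' := funext fun x => by
        rw [inv_one, mul_one, rep_coe]
        rfl
      map_mul' := fun g k => funext fun x => by
        change _ = hS.rep (hS.rep (x * k⁻¹) * g⁻¹)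
        rw [rep_rep_mul, mul_inv_rev, mul_assoc] }

theorem toPerm_apply (hS : IsRightTransversal H S) (g : G) (x : S) :
    hS.toPerm g x = hS.rep (x * g⁻¹) := rfl

/-- The stabilizer of the coset `H` itself is `H`. -/
theorem ker_toPerm_le (hS : IsRightTransversal H S) : hS.toPerm.ker ≤ H := by
  intro g hg
  have h : hS.toPerm g ⟨1, hS.one_mem⟩ = ⟨1, hS.one_mem⟩ := by
    rw [MonoidHom.mem_ker.1 hg]; rfl
  rw [toPerm_apply, rep_eq_iff] at h
  simpa using h

theorem toPerm_injective (hS : IsRightTransversal H S) (hcore : H.normalCore = ⊥) :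
    Function.Injective hS.toPerm := by
  rw [← MonoidHom.ker_eq_bot_iff, eq_bot_iff, ← hcore]
  exact Subgroup.normal_le_normalCore.2 hS.ker_toPerm_le

theorem toPerm_mem_rightMulGroup (hS : IsRightTransversal H S)
    (hgen : Subgroup.closure S = ⊤) (g : G) :
    hS.toPerm g ∈ @RightLoop.rightMulGroup S hS.rightLoop := by
  let := hS.rightLoop
  have hle : Subgroup.closure S ≤ (RightLoop.rightMulGroup S).comap hS.toPerm := by
    rw [Subgroup.closure_le]
    intro s hs
    -- Since `g` acts through `x * g⁻¹`, it is `s⁻¹` that acts as right translation by `s`.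
    rw [SetLike.mem_coe, Subgroup.mem_comap, ← Subgroup.inv_mem_iff, ← map_inv]
    refine Subgroup.subset_closure ⟨⟨s, hs⟩, Equiv.ext fun x => ?_⟩
    rw [toPerm_apply, inv_inv]
    rfl
  exact hle (hgen ▸ Subgroup.mem_top g)

theorem isSolvable_of_isNilpotent (hS : IsRightTransversal H S) (hcore : H.normalCore = ⊥)
    (hgen : Subgroup.closure S = ⊤) (hnil : hS.IsNilpotent) : Group.IsSolvable G := by
  let := hS.rightLoop
  have := RightLoop.IsNilpotent.isSolvable_rightMulGroup hnil
  exact Group.isSolvable_of_isSolvable_injective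
    (f := hS.toPerm.codRestrict (RightLoop.rightMulGroup S) (hS.toPerm_mem_rightMulGroup hgen))
    fun _ _ h => hS.toPerm_injective hcore (congrArg Subtype.val h)

end IsRightTransversal

theorem mainTheorem6 {G : Type*} [Group G] (H : Subgroup G) (hcore : H.normalCore = ⊥)
    (S : Set G) (hS : IsRightTransversal H S) (hgen : Subgroup.closure S = ⊤)
    (hnil : hS.IsNilpotent) : Group.IsSolvable H := by
  have := hS.isSolvable_of_isNilpotent hcore hgen hnil
  infer_instance
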